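/- Let $\kappa$ be an infinite regular cardinal or the symbol $\infty$ (bigger than all cardinals); "$\kappa$-ary" means of size $<\kappa$ (for $\kappa=\infty$: indexed by an arbitrary small set). A $(\kappa,\kappa)$-frame is a poset with $\kappa$-ary meets and $\kappa$-ary joins in which finite meets distribute over $\kappa$-ary joins and finite joins distribute over $\kappa$-ary meets; homomorphisms are the maps preserving $\kappa$-ary meets and joins. Let $I,J$ be $\kappa$-ary index sets, let $A$, $B_i$ ($i\in I$), $C_j$ ($j\in J$) be $(\kappa,\kappa)$-frames with homomorphisms $f_i:A\to B_i$ and $g_j:A\to C_j$, and let $D$ be their bilax pushout, i.e. the universal $(\kappa,\kappa)$-frame equipped with homomorphisms $\iota:A\to D$, $\iota_i:B_i\to D$, $\iota_j:C_j\to D$ such that $\iota_i\circ f_i\le\iota$ for each $i\in I$ and $\iota\le\iota_j\circ g_j$ for each $j\in J$ (pointwise). Let $a^L,a^R\in A$, $b^L_i,b^R_i\in B_i$ for each $i$, and $c^L_j,c^R_j\in C_j$ for each $j$. If $$\iota(a^L)\wedge\bigwedge_i\iota_i(b^L_i)\wedge\bigwedge_j\iota_j(c^L_j)\ \le\ \iota(a^R)\vee\bigvee_i\iota_i(b^R_i)\vee\bigvee_j\iota_j(c^R_j)\quad\text{in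 }D,$$ then there are $a^L_i\in A$ ($i\in I$) and $a^R_j\in A$ ($j\in J$) such that $$\bigwedge_i a^L_i\wedge a^L\le a^R\vee\bigvee_j a^R_j\ \text{ in }A,$$ $$b^L_i\le f_i(a^L_i)\vee b^R_i\ \text{ in }B_i\text{ for every }i,\qquad c^L_j\wedge g_j(a^R_j)\le c^R_j\ \text{ in }C_j\text{ for every }j.$$ -/

import Mathlib

universe u v w

/-- An arity bound `κ`: a cardinal, or the symbol `∞ = ⊤` bigger than all (small) cardinals. -/
abbrev Arity : Type (u + 1) := WithTop Cardinal.{u}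

/-- `κ` is an infinite regular cardinal or the symbol `∞`
(`Cardinal.IsRegular` includes being infinite). -/
def Arity.IsInfiniteRegular (κ : Arity.{u}) : Prop :=
  κ = ⊤ ∨ ∃ c : Cardinal.{u}, κ = (c : WithTop Cardinal.{u}) ∧ c.IsRegular

/-- A (small) set is `κ`-ary if it has fewer than `κ` elements; every small set is `∞`-ary. -/
def IsAry (κ : Arity.{u}) (I : Type u) : Prop :=
  ((Cardinal.mk I : Cardinal.{u}) : WithTop Cardinal.{u}) < κ

/-- `IsFrm l k A`: the lattice `A` is an `(l, k)`-frame, that is, it has `l`-ary meets and `k`-ary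
joins, binary meets distribute over `k`-ary joins, and binary joins distribute over `l`-ary meets.
(The lattice operations and the bounds are the finite meets and joins of the underlying poset.) -/
class IsFrm (l k : Arity.{u}) (A : Type v) [Lattice A] [BoundedOrder A] : Prop where
  exists_isLUB : ∀ (I : Type u), IsAry k I → ∀ b : I → A, ∃ s, IsLUB (Set.range b) s
  exists_isGLB : ∀ (I : Type u), IsAry l I → ∀ b : I → A, ∃ m, IsGLB (Set.range b) m
  inf_isLUB : ∀ (I : Type u), IsAry k I → ∀ (a : A) (b : I → A) (s : A),
    IsLUB (Set.range b) s → IsLUB (Set.range fun i => a ⊓ b i) (a ⊓ s)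
  sup_isGLB : ∀ (I : Type u), IsAry l I → ∀ (a : A) (b : I → A) (m : A),
    IsGLB (Set.range b) m → IsGLB (Set.range fun i => a ⊔ b i) (a ⊔ m)

/-- Homomorphisms of `(l, k)`-frames: maps preserving `k`-ary joins and `l`-ary meets. -/
structure IsFrmHom (l k : Arity.{u}) {A : Type v} {B : Type w} [Preorder A] [Preorder B]
    (h : A → B) : Prop where
  map_isLUB : ∀ (I : Type u), IsAry k I → ∀ (b : I → A) (s : A),
    IsLUB (Set.range b) s → IsLUB (Set.range fun i => h (b i)) (h s)
  map_isGLB : ∀ (I : Type u), IsAry l I → ∀ (b : I → A) (m : A),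
    IsGLB (Set.range b) m → IsGLB (Set.range fun i => h (b i)) (h m)

open Classical in
/-- The join of a family; it is only used for families that have a join. -/
noncomputable def famSup {I : Type u} {A : Type v} [Lattice A] [BoundedOrder A] (b : I → A) : A :=
  if h : ∃ s, IsLUB (Set.range b) s then h.choose else ⊥

open Classical in
/-- The meet of a family; it is only used for families that have a meet. -/
noncomputable def famInf {I : Type u} {A : Type v} [Lattice A] [BoundedOrder A] (b : I → A) : A :=
  if h : ∃ m, IsGLB (Set.range b) m then h.choose else ⊤

theorem isLUB_famSup {l k : Arity.{u}} {I : Type u} {A : Type v} [Lattice A] [BoundedOrder A]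
    [IsFrm l k A] (hI : IsAry k I) (b : I → A) : IsLUB (Set.range b) (famSup b) := by
  have h := IsFrm.exists_isLUB (l := l) I hI b
  rw [famSup, dif_pos h]
  exact h.choose_spec

theorem isGLB_famInf {l k : Arity.{u}} {I : Type u} {A : Type v} [Lattice A] [BoundedOrder A]
    [IsFrm l k A] (hI : IsAry l I) (b : I → A) : IsGLB (Set.range b) (famInf b) := by
  have h := IsFrm.exists_isGLB (k := k) I hI b
  rw [famInf, dif_pos h]
  exact h.choose_spec

/-- Homomorphisms `ι : A → D`, `ιB i : B i → D`, `ιC j : C j → D` of `(κ, κ)`-frames such that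
`ιB i ∘ f i ≤ ι ≤ ιC j ∘ g j` for all `i`, `j`. -/
structure IsBilaxCocone (κ : Arity.{u}) {I J : Type u} {A : Type v} {B : I → Type v}
    {C : J → Type v} [Lattice A] [∀ i, Lattice (B i)] [∀ j, Lattice (C j)]
    (f : ∀ i, A → B i) (g : ∀ j, A → C j) {D : Type w} [Lattice D]
    (ι : A → D) (ιB : ∀ i, B i → D) (ιC : ∀ j, C j → D) : Prop where
  hom : IsFrmHom κ κ ι
  hom_B : ∀ i, IsFrmHom κ κ (ιB i)
  hom_C : ∀ j, IsFrmHom κ κ (ιC j)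
  le_B : ∀ i a, ιB i (f i a) ≤ ι a
  le_C : ∀ j a, ι a ≤ ιC j (g j a)

/-- `D`, with `ι`, `ιB`, `ιC`, is the bilax pushout of the `f i : A → B i` and `g j : A → C j`: the
universal `(κ, κ)`-frame with such homomorphisms. The test frames `E` range over a universe
containing all the data, `D` included; when `κ = ∞`, `D` may be a large structure (`w = u + 1`). -/
structure IsBilaxPushout (κ : Arity.{u}) {I J : Type u} {A : Type v} {B : I → Type v}
    {C : J → Type v} [Lattice A] [∀ i, Lattice (B i)] [∀ j, Lattice (C j)]
    (f : ∀ i, A → B i) (g : ∀ j, A → C j) {D : Type w} [Lattice D]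
    (ι : A → D) (ιB : ∀ i, B i → D) (ιC : ∀ j, C j → D) : Prop where
  cocone : IsBilaxCocone κ f g ι ιB ιC
  existsUnique_hom : ∀ (E : Type (max u v w)) [Lattice E] [BoundedOrder E] [IsFrm κ κ E]
    (e : A → E) (eB : ∀ i, B i → E) (eC : ∀ j, C j → E), IsBilaxCocone κ f g e eB eC →
    ∃! h : D → E, IsFrmHom κ κ h ∧ (∀ a, h (ι a) = e a) ∧
      (∀ i b, h (ιB i b) = eB i b) ∧ (∀ j c, h (ιC j c) = eC j c)

/-! ### Finite operations in `(κ, κ)`-frames -/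

/-! Interpolation by forcing, without constructing `D`. Read the data as a sequent, provable when
interpolants exist. If it is not provable, take the poset of all unprovable sequents, a stronger one
having smaller left and larger right entries. Its regular lower sets form a complete Boolean
algebra, hence a `(κ, κ)`-frame. Each of `A`, `B i`, `C j` maps into it, sending `x` to the
conditions none of whose strengthenings has `x` below its right entry.

These maps are homomorphisms because provability is closed under valid rules
(`isInterpolable_of_aRule`, `isInterpolable_of_bRule`, `isInterpolable_of_cRule`): interpolants of
the premises combine by `κ`-ary meets and joins. They form a bilax cocone because the corresponding
axioms are provable. The universal property then gives a map out of `D` under which the given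
sequent forces the left side of the assumed inequality and refutes the right side. -/

theorem Arity.IsInfiniteRegular.isAry_of_finite {κ : Arity.{u}} (hκ : κ.IsInfiniteRegular)
    (I : Type u) [Finite I] : IsAry κ I := by
  rcases hκ with rfl | ⟨c, rfl, hc⟩
  · exact WithTop.coe_lt_top _
  · exact WithTop.coe_lt_coe.2 ((Cardinal.lt_aleph0_of_finite I).trans_le hc.aleph0_le)

/-- The two-element family `a, b`. -/
def pairFam {A : Type v} (a b : A) : ULift.{u} Bool → A := fun t => bif t.down then a else b

theorem range_pairFam {A : Type v} (a b : A) : Set.range (pairFam.{u} a b) = {a, b} := by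
  ext x
  simp [pairFam, eq_comm, or_comm]

theorem comp_pairFam {A : Type v} {B : Type w} (h : A → B) (a b : A) :
    (fun t => h (pairFam.{u} a b t)) = pairFam (h a) (h b) := by
  funext ⟨t⟩
  cases t <;> rfl

/-- Cut: by distributivity `a = a ⊓ (t ⊔ b)` is the join of `a ⊓ t` and `a ⊓ b`. -/
theorem le_of_inf_le_of_le_sup {κ : Arity.{u}} (hκ : κ.IsInfiniteRegular) {A : Type v} [Lattice A]
    [BoundedOrder A] [IsFrm κ κ A] {a b t : A} (h₁ : a ⊓ b ≤ t) (h₂ : a ≤ t ⊔ b) : a ≤ t := by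
  have h := IsFrm.inf_isLUB (l := κ) _ (hκ.isAry_of_finite _) a (pairFam.{u} t b) (t ⊔ b)
    (by rw [range_pairFam]; exact isLUB_pair)
  rw [comp_pairFam (fun x => a ⊓ x), range_pairFam, inf_eq_left.2 h₂] at h
  exact h.2 (by rintro x (rfl | rfl); exacts [inf_le_right, h₁])

namespace IsFrmHom

variable {κ : Arity.{u}} {A : Type v} {B : Type w} [Lattice A] [Lattice B] {h : A → B}

theorem map_sup (hh : IsFrmHom κ κ h) (hκ : κ.IsInfiniteRegular) (a b : A) :
    h (a ⊔ b) = h a ⊔ h b := by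
  have := hh.map_isLUB _ (hκ.isAry_of_finite _) (pairFam.{u} a b) (a ⊔ b)
    (by rw [range_pairFam]; exact isLUB_pair)
  rw [comp_pairFam, range_pairFam] at this
  exact this.unique isLUB_pair

theorem map_inf (hh : IsFrmHom κ κ h) (hκ : κ.IsInfiniteRegular) (a b : A) :
    h (a ⊓ b) = h a ⊓ h b := by
  have := hh.map_isGLB _ (hκ.isAry_of_finite _) (pairFam.{u} a b) (a ⊓ b)
    (by rw [range_pairFam]; exact isGLB_pair)
  rw [comp_pairFam, range_pairFam] at this
  exact this.unique isGLB_pair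

theorem monotone (hh : IsFrmHom κ κ h) (hκ : κ.IsInfiniteRegular) : Monotone h := fun a b hab => by
  rw [← sup_eq_right.2 hab, hh.map_sup hκ]
  exact le_sup_left

theorem map_top [BoundedOrder A] [BoundedOrder B] (hh : IsFrmHom κ κ h)
    (hκ : κ.IsInfiniteRegular) : h ⊤ = ⊤ := by
  have := hh.map_isGLB PEmpty (hκ.isAry_of_finite _) PEmpty.elim ⊤
    (by rw [Set.range_eq_empty]; exact isGLB_empty)
  rw [Set.range_eq_empty] at this
  exact this.unique isGLB_empty

theorem map_bot [BoundedOrder A] [BoundedOrder B] (hh : IsFrmHom κ κ h)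
    (hκ : κ.IsInfiniteRegular) : h ⊥ = ⊥ := by
  have := hh.map_isLUB PEmpty (hκ.isAry_of_finite _) PEmpty.elim ⊥
    (by rw [Set.range_eq_empty]; exact isLUB_empty)
  rw [Set.range_eq_empty] at this
  exact this.unique isLUB_empty

end IsFrmHom

/-! ### Families with a meet or a join -/

section Fam

variable {κ : Arity.{u}} {A : Type v} [Lattice A] [BoundedOrder A] [IsFrm κ κ A] {K : Type u}

theorem le_famSup (hK : IsAry κ K) (a : K → A) (k : K) : a k ≤ famSup a :=
  (isLUB_famSup (l := κ) hK a).1 ⟨k, rfl⟩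

theorem famSup_le (hK : IsAry κ K) {a : K → A} {t : A} (h : ∀ k, a k ≤ t) : famSup a ≤ t :=
  (isLUB_famSup (l := κ) hK a).2 (by rintro _ ⟨k, rfl⟩; exact h k)

theorem famInf_le (hK : IsAry κ K) (a : K → A) (k : K) : famInf a ≤ a k :=
  (isGLB_famInf (k := κ) hK a).1 ⟨k, rfl⟩

theorem le_famInf (hK : IsAry κ K) {a : K → A} {t : A} (h : ∀ k, t ≤ a k) : t ≤ famInf a :=
  (isGLB_famInf (k := κ) hK a).2 (by rintro _ ⟨k, rfl⟩; exact h k)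

theorem inf_le_of_isLUB (hK : IsAry κ K) {a : K → A} {s t x : A} (hs : IsLUB (Set.range a) s)
    (h : ∀ k, x ⊓ a k ≤ t) : x ⊓ s ≤ t :=
  (IsFrm.inf_isLUB (l := κ) K hK x a s hs).2 (by rintro _ ⟨k, rfl⟩; exact h k)

theorem le_sup_of_isGLB (hK : IsAry κ K) {a : K → A} {m t x : A} (hm : IsGLB (Set.range a) m)
    (h : ∀ k, t ≤ x ⊔ a k) : t ≤ x ⊔ m :=
  (IsFrm.sup_isGLB (k := κ) K hK x a m hm).2 (by rintro _ ⟨k, rfl⟩; exact h k)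

variable {B : Type w} [Lattice B] [BoundedOrder B] [IsFrm κ κ B] {h : A → B}

theorem IsFrmHom.le_map_famInf_sup (hh : IsFrmHom κ κ h) (hK : IsAry κ K) {a : K → A} {l r : B}
    (H : ∀ k, l ≤ h (a k) ⊔ r) : l ≤ h (famInf a) ⊔ r := by
  rw [sup_comm]
  exact le_sup_of_isGLB hK (hh.map_isGLB K hK a _ (isGLB_famInf (k := κ) hK a))
    fun k => (H k).trans_eq (sup_comm _ _)

theorem IsFrmHom.inf_map_famSup_le (hh : IsFrmHom κ κ h) (hK : IsAry κ K) {a : K → A} {l r : B}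
    (H : ∀ k, l ⊓ h (a k) ≤ r) : l ⊓ h (famSup a) ≤ r :=
  inf_le_of_isLUB hK (hh.map_isLUB K hK a _ (isLUB_famSup (l := κ) hK a)) H

end Fam

/-! ### The complete Boolean algebra of regular lower sets of a poset -/

/-- The regular open algebra of `P`, for the topology of lower sets. -/
abbrev RegularLowerSet (P : Type v) [Preorder P] : Type v := Heyting.Regular (LowerSet P)

/-- Joins are double complements of unions. Both distributive laws hold for all existing joins and
meets of a Boolean algebra, by the adjunctions for `⇨` and `\`. -/
instance {κ : Arity.{u}} {P : Type v} [Preorder P] : IsFrm κ κ (RegularLowerSet P) where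
  exists_isLUB I _ b := by
    refine ⟨Heyting.Regular.toRegular (⨆ i, (b i : LowerSet P)), ?_, ?_⟩
    · rintro _ ⟨i, rfl⟩
      rw [← Heyting.Regular.coe_le_coe, Heyting.Regular.coe_toRegular]
      exact (le_iSup (fun i => (b i : LowerSet P)) i).trans le_compl_compl
    · intro t ht
      rw [← Heyting.Regular.coe_le_coe, Heyting.Regular.coe_toRegular, ← t.prop.eq]
      exact compl_le_compl (compl_le_compl
        (iSup_le fun i => Heyting.Regular.coe_le_coe.2 (ht ⟨i, rfl⟩)))
  exists_isGLB I _ b := by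
    refine ⟨Heyting.Regular.toRegular (⨅ i, (b i : LowerSet P)), ?_, ?_⟩
    · rintro _ ⟨i, rfl⟩
      rw [← Heyting.Regular.coe_le_coe, Heyting.Regular.coe_toRegular, ← (b i).prop.eq]
      exact compl_le_compl (compl_le_compl (iInf_le (fun i => (b i : LowerSet P)) i))
    · intro t ht
      rw [← Heyting.Regular.coe_le_coe, Heyting.Regular.coe_toRegular]
      exact (le_iInf fun i => Heyting.Regular.coe_le_coe.2 (ht ⟨i, rfl⟩)).trans le_compl_compl
  inf_isLUB I _ a b s hs := by
    refine ⟨?_, fun t ht => ?_⟩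
    · rintro _ ⟨i, rfl⟩
      exact inf_le_inf_left a (hs.1 ⟨i, rfl⟩)
    · rw [← le_himp_iff']
      refine hs.2 ?_
      rintro _ ⟨i, rfl⟩
      rw [le_himp_iff']
      exact ht ⟨i, rfl⟩
  sup_isGLB I _ a b m hm := by
    refine ⟨?_, fun t ht => ?_⟩
    · rintro _ ⟨i, rfl⟩
      exact sup_le_sup_left (hm.1 ⟨i, rfl⟩) a
    · rw [← sdiff_le_iff]
      refine hm.2 ?_
      rintro _ ⟨i, rfl⟩
      rw [sdiff_le_iff]
      exact ht ⟨i, rfl⟩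

theorem LowerSet.mem_heyting_compl {P : Type v} [Preorder P] {S : LowerSet P} {p : P} :
    p ∈ Sᶜ ↔ ∀ q ≤ p, q ∉ S := by
  rw [← LowerSet.Iic_le, le_compl_iff_disjoint_right, disjoint_iff_inf_le]
  exact ⟨fun h q hq hS => h ⟨hq, hS⟩, fun h q hq => h q hq.1 hq.2⟩

/-! ### Forcing by conditions that carry sequents of a frame -/

/-- The sequent `l ⊢ r` follows in every lattice extension by context from the `l' k ⊢ r' k`. -/
def IsValidRule {X : Type v} [Lattice X] {K : Type u} (l r : X) (l' r' : K → X) : Prop :=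
  ∀ x y, (∀ k, l' k ⊓ x ≤ r' k ⊔ y) → l ⊓ x ≤ r ⊔ y

/-- Each condition `p : P` carries a sequent `l p ⊢ r p` of `X`, stronger conditions carry weaker
sequents, and every valid rule that concludes the sequent of `p` has a premise carried by some
strengthening of `p`. -/
structure IsSlot (κ : Arity.{u}) {P : Type w} [Preorder P] {X : Type v} [Lattice X]
    (l r : P → X) : Prop where
  monotone : Monotone l
  antitone : Antitone r
  exists_le : ∀ (p : P) (K : Type u), IsAry κ K → ∀ l' r' : K → X, (∀ k, l' k ≤ l p) →
    (∀ k, r p ≤ r' k) → IsValidRule (l p) (r p) l' r' → ∃ k, ∃ q ≤ p, l q ≤ l' k ∧ r' k ≤ r q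

namespace IsSlot

variable {κ : Arity.{u}} {P : Type w} [Preorder P] {X : Type v} [Lattice X] {l r : P → X}

/-- The regular lower set of the conditions that force `x`. -/
def val (hs : IsSlot κ l r) (x : X) : RegularLowerSet P :=
  ⟨(⟨{p | x ≤ r p}, fun _ _ hqp hp => le_trans hp (hs.antitone hqp)⟩ : LowerSet P)ᶜ,
    Heyting.isRegular_compl _⟩

theorem mem_val (hs : IsSlot κ l r) {x : X} {p : P} :
    p ∈ (hs.val x : LowerSet P) ↔ ∀ q ≤ p, ¬ x ≤ r q :=
  LowerSet.mem_heyting_compl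

/-- If `l p ≤ r p`, the sequent of `p` is an axiom, a valid rule with no premise to strengthen to.
-/
theorem not_le (hs : IsSlot κ l r) (hκ : κ.IsInfiniteRegular) (p : P) : ¬ l p ≤ r p := fun h =>
  have ⟨k, _⟩ := hs.exists_le p PEmpty (hκ.isAry_of_finite _) PEmpty.elim PEmpty.elim
    (fun k => k.elim) (fun k => k.elim) fun _ _ _ => (inf_le_left.trans h).trans le_sup_left
  k.elim

theorem mem_val_of_le (hs : IsSlot κ l r) (hκ : κ.IsInfiniteRegular) {x : X} {p : P}
    (h : l p ≤ x) : p ∈ (hs.val x : LowerSet P) :=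
  hs.mem_val.2 fun q hq hx => hs.not_le hκ q ((hs.monotone hq).trans (h.trans hx))

theorem notMem_val_of_le (hs : IsSlot κ l r) {x : X} {p : P}
    (h : x ≤ r p) : p ∉ (hs.val x : LowerSet P) :=
  fun hp => hs.mem_val.1 hp p le_rfl h

variable [BoundedOrder X] [IsFrm κ κ X]

/-- The conditions that decide `x` are dense: apply the cut rule, with premises `l p ⊓ x ⊢ r p` and
`l p ⊢ r p ⊔ x`. -/
theorem exists_le_or_le (hs : IsSlot κ l r) (hκ : κ.IsInfiniteRegular) (p : P) (x : X) :
    ∃ q ≤ p, l q ≤ x ∨ x ≤ r q := by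
  obtain ⟨⟨k⟩, q, hq, h₁, h₂⟩ := hs.exists_le p (ULift Bool) (hκ.isAry_of_finite _)
    (pairFam (l p ⊓ x) (l p)) (pairFam (r p) (r p ⊔ x))
    (by rintro ⟨_ | _⟩; exacts [le_rfl, inf_le_left])
    (by rintro ⟨_ | _⟩; exacts [le_sup_left, le_rfl]) fun y z h => by
      refine le_of_inf_le_of_le_sup hκ (b := x) ?_ ?_
      · rw [inf_right_comm]
        exact h ⟨true⟩
      · rw [sup_right_comm]
        exact h ⟨false⟩
  cases k
  · exact ⟨q, hq, Or.inr (le_sup_right.trans h₂)⟩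
  · exact ⟨q, hq, Or.inl (h₁.trans inf_le_right)⟩

theorem isFrmHom_val (hs : IsSlot κ l r) (hκ : κ.IsInfiniteRegular) : IsFrmHom κ κ hs.val where
  map_isLUB K hK b s hb := by
    refine ⟨?_, fun U hU => ?_⟩
    · rintro _ ⟨k, rfl⟩ p hp
      exact hs.mem_val.2 fun q hq hx => hs.mem_val.1 hp q hq (le_trans (hb.1 ⟨k, rfl⟩) hx)
    · intro p hp
      rw [← U.prop.eq]
      refine LowerSet.mem_heyting_compl.2 fun q hq hqU => ?_
      -- Once `l q' ≤ s`, the left rule for joins strengthens `q'` to a condition that forces some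
      -- `b k`, hence lies in `U`, against `q ∈ Uᶜ`.
      obtain ⟨q', hq', h | h⟩ := hs.exists_le_or_le hκ q s
      · obtain ⟨k, t, ht, h₁, -⟩ := hs.exists_le q' K hK (fun k => l q' ⊓ b k) (fun _ => r q')
          (fun _ => inf_le_left) (fun _ => le_rfl) fun x y H => by
            rw [← inf_eq_left.2 h, inf_right_comm]
            exact inf_le_of_isLUB hK hb fun k => by rw [inf_right_comm]; exact H k
        exact LowerSet.mem_heyting_compl.1 hqU t (ht.trans hq')
          (hU ⟨k, rfl⟩ (hs.mem_val_of_le hκ (h₁.trans inf_le_right)))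
      · exact hs.mem_val.1 hp q' (hq'.trans hq) h
  map_isGLB K hK b m hb := by
    refine ⟨?_, fun U hU => ?_⟩
    · rintro _ ⟨k, rfl⟩ p hp
      obtain hk : m ≤ b k := hb.1 ⟨k, rfl⟩
      exact hs.mem_val.2 fun q hq hx => hs.mem_val.1 hp q hq (hk.trans hx)
    · intro p hp
      refine hs.mem_val.2 fun q hq hm => ?_
      -- The right rule for meets: if `m` is below the right entry of `q`, some `b k` is below that
      -- of a strengthening. No cut is needed.
      obtain ⟨k, t, ht, -, h₂⟩ := hs.exists_le q K hK (fun _ => l q) (fun k => r q ⊔ b k)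
        (fun _ => le_rfl) (fun _ => le_sup_left) fun x y H => by
          rw [← sup_eq_left.2 hm, sup_right_comm]
          exact le_sup_of_isGLB hK hb fun k => by rw [sup_right_comm]; exact H k
      exact hs.mem_val.1 (hU ⟨k, rfl⟩ ((U : LowerSet P).lower (ht.trans hq) hp)) t le_rfl
        (le_sup_right.trans h₂)

end IsSlot

/-! ### Interpolable sequents -/

/-- A sequent with one formula on either side from each of `A`, the `B i` and the `C j`. -/
structure BilaxSequent {I J : Type u} (A : Type v) (B : I → Type v) (C : J → Type v) where
  aL : A
  aR : A
  bL : ∀ i, B i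
  bR : ∀ i, B i
  cL : ∀ j, C j
  cR : ∀ j, C j

namespace BilaxSequent

variable {κ : Arity.{u}} {I J : Type u} {A : Type v} {B : I → Type v} {C : J → Type v}
  [Lattice A] [∀ i, Lattice (B i)] [∀ j, Lattice (C j)]

instance : Preorder (BilaxSequent A B C) where
  le p q := (p.aL ≤ q.aL ∧ q.aR ≤ p.aR) ∧ (p.bL ≤ q.bL ∧ q.bR ≤ p.bR) ∧ p.cL ≤ q.cL ∧ q.cR ≤ p.cR
  le_refl p := ⟨⟨le_rfl, le_rfl⟩, ⟨le_rfl, le_rfl⟩, le_rfl, le_rfl⟩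
  le_trans p q r h h' := ⟨⟨h.1.1.trans h'.1.1, h'.1.2.trans h.1.2⟩,
    ⟨h.2.1.1.trans h'.2.1.1, h'.2.1.2.trans h.2.1.2⟩, h.2.2.1.trans h'.2.2.1,
    h'.2.2.2.trans h.2.2.2⟩

variable [BoundedOrder A] (f : ∀ i, A → B i) (g : ∀ j, A → C j)

/-- There are interpolants, elements of `A` which prove the sequent. -/
def IsInterpolable (p : BilaxSequent A B C) : Prop :=
  ∃ (aL' : I → A) (aR' : J → A),
    famInf aL' ⊓ p.aL ≤ p.aR ⊔ famSup aR' ∧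
    (∀ i, p.bL i ≤ f i (aL' i) ⊔ p.bR i) ∧
    (∀ j, p.cL j ⊓ g j (aR' j) ≤ p.cR j)

variable {f g} [IsFrm κ κ A] [∀ i, BoundedOrder (B i)] [∀ j, BoundedOrder (C j)]

/-- The interpolant is `a` at `i₀`; the trivial `⊤` and `⊥` elsewhere work because homomorphisms
preserve them. -/
theorem isInterpolable_of_b_le_a (hκ : κ.IsInfiniteRegular) (hI : IsAry κ I)
    (hf : ∀ i, IsFrmHom κ κ (f i)) (hg : ∀ j, IsFrmHom κ κ (g j))
    {p : BilaxSequent A B C} {i₀ : I} {a : A} (hb : p.bL i₀ ≤ f i₀ a) (ha : a ≤ p.aR) :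
    IsInterpolable f g p := by
  classical
  refine ⟨Function.update (fun _ => ⊤) i₀ a, fun _ => ⊥, ?_, fun i => ?_, fun j => ?_⟩
  · have := famInf_le hI (Function.update (fun _ => (⊤ : A)) i₀ a) i₀
    rw [Function.update_self] at this
    exact (inf_le_left.trans (this.trans ha)).trans le_sup_left
  · by_cases hi : i = i₀
    · subst hi
      rw [Function.update_self]
      exact hb.trans le_sup_left
    · rw [Function.update_of_ne hi, (hf i).map_top hκ, top_sup_eq]
      exact le_top
  · rw [(hg j).map_bot hκ, inf_bot_eq]
    exact bot_le

theorem isInterpolable_of_a_le_c (hκ : κ.IsInfiniteRegular) (hJ : IsAry κ J)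
    (hf : ∀ i, IsFrmHom κ κ (f i)) (hg : ∀ j, IsFrmHom κ κ (g j))
    {p : BilaxSequent A B C} {j₀ : J} {a : A} (ha : p.aL ≤ a) (hc : g j₀ a ≤ p.cR j₀) :
    IsInterpolable f g p := by
  classical
  refine ⟨fun _ => ⊤, Function.update (fun _ => ⊥) j₀ a, ?_, fun i => ?_, fun j => ?_⟩
  · have := le_famSup hJ (Function.update (fun _ => (⊥ : A)) j₀ a) j₀
    rw [Function.update_self] at this
    exact inf_le_right.trans ((ha.trans this).trans le_sup_right)
  · rw [(hf i).map_top hκ, top_sup_eq]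
    exact le_top
  · by_cases hj : j = j₀
    · subst hj
      rw [Function.update_self]
      exact inf_le_right.trans hc
    · rw [Function.update_of_ne hj, (hg j).map_bot hκ, inf_bot_eq]
      exact bot_le

variable [∀ i, IsFrm κ κ (B i)] [∀ j, IsFrm κ κ (C j)] {K : Type u}

/-- Take meets over `k` of the `B`-side interpolants and joins over `k` of the `C`-side ones. The
resulting total meet and join serve as the context in which the rule is applied in `A`. -/
theorem isInterpolable_of_aRule (hI : IsAry κ I) (hJ : IsAry κ J) (hK : IsAry κ K)
    (hf : ∀ i, IsFrmHom κ κ (f i)) (hg : ∀ j, IsFrmHom κ κ (g j))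
    {p : BilaxSequent A B C} {l r : K → A} (hv : IsValidRule p.aL p.aR l r)
    (H : ∀ k, IsInterpolable f g { p with aL := l k, aR := r k }) : IsInterpolable f g p := by
  choose x y hA hB hC using H
  refine ⟨fun i => famInf fun k => x k i, fun j => famSup fun k => y k j, ?_,
    fun i => (hf i).le_map_famInf_sup hK fun k => hB k i,
    fun j => (hg j).inf_map_famSup_le hK fun k => hC k j⟩
  rw [inf_comm]
  refine hv _ _ fun k => ?_
  rw [inf_comm]
  refine (inf_le_inf_right _ (le_famInf hI fun i => ?_)).trans
    ((hA k).trans (sup_le_sup_left (famSup_le hJ fun j => ?_) _))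
  · exact (famInf_le hI _ i).trans (famInf_le hK (fun k => x k i) k)
  · exact (le_famSup hK (fun k => y k j) k).trans
      (le_famSup hJ (fun j => famSup fun k => y k j) j)

-- At `i₀` the interpolants are joined instead of met: the rule in `B i₀` needs a single context `f
-- i₀ a` above all those of the premises. In `A`, distributing the meet over this join returns to
-- the individual premises.
open Classical in
theorem isInterpolable_of_bRule (hκ : κ.IsInfiniteRegular) (hI : IsAry κ I) (hJ : IsAry κ J)
    (hK : IsAry κ K) (hf : ∀ i, IsFrmHom κ κ (f i)) (hg : ∀ j, IsFrmHom κ κ (g j))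
    {p : BilaxSequent A B C} (i₀ : I) {l r : K → B i₀} (hv : IsValidRule (p.bL i₀) (p.bR i₀) l r)
    (H : ∀ k, IsInterpolable f g { p with
      bL := Function.update p.bL i₀ (l k), bR := Function.update p.bR i₀ (r k) }) :
    IsInterpolable f g p := by
  choose x y hA hB hC using H
  refine ⟨Function.update (fun i => famInf fun k => x k i) i₀ (famSup fun k => x k i₀),
    fun j => famSup fun k => y k j, ?_, fun i => ?_,
    fun j => (hg j).inf_map_famSup_le hK fun k => hC k j⟩
  · set z := Function.update (fun i => famInf fun k => x k i) i₀ (famSup fun k => x k i₀) with hz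
    have hz₀ : famInf z ≤ famSup fun k => x k i₀ := by
      simpa [hz] using famInf_le hI z i₀
    -- Make the join over `k` an explicit factor, so that the meet distributes over it.
    rw [← inf_eq_left.2 hz₀, inf_right_comm]
    refine inf_le_of_isLUB hK (isLUB_famSup (l := κ) hK _) fun k => ?_
    refine (le_inf (le_famInf hI fun i => ?_) (inf_le_left.trans inf_le_right)).trans
      ((hA k).trans (sup_le_sup_left (famSup_le hJ fun j => ?_) _))
    · by_cases hi : i = i₀
      · subst hi
        exact inf_le_right
      · have := famInf_le hI z i
        rw [hz, Function.update_of_ne hi] at this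
        exact inf_le_left.trans (inf_le_left.trans
          (this.trans (famInf_le hK (fun k => x k i) k)))
    · exact (le_famSup hK (fun k => y k j) k).trans
        (le_famSup hJ (fun j => famSup fun k => y k j) j)
  · by_cases hi : i = i₀
    · subst hi
      have := hv ⊤ (f i (famSup fun k => x k i)) fun k => by
        have := hB k i
        simp only [Function.update_self] at this
        rw [inf_top_eq, sup_comm]
        exact this.trans (sup_le_sup_right
          ((hf i).monotone hκ (le_famSup hK (fun k => x k i) k)) _)
      rw [inf_top_eq, sup_comm] at this
      simpa using this
    · rw [Function.update_of_ne hi]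
      refine (hf i).le_map_famInf_sup hK fun k => ?_
      simpa [Function.update_of_ne hi] using hB k i

-- Dual to the rule for `B`: at `j₀` the interpolants are met, and in `A` the join distributes over
-- this meet.
open Classical in
theorem isInterpolable_of_cRule (hκ : κ.IsInfiniteRegular) (hI : IsAry κ I) (hJ : IsAry κ J)
    (hK : IsAry κ K) (hf : ∀ i, IsFrmHom κ κ (f i)) (hg : ∀ j, IsFrmHom κ κ (g j))
    {p : BilaxSequent A B C} (j₀ : J) {l r : K → C j₀} (hv : IsValidRule (p.cL j₀) (p.cR j₀) l r)
    (H : ∀ k, IsInterpolable f g { p with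
      cL := Function.update p.cL j₀ (l k), cR := Function.update p.cR j₀ (r k) }) :
    IsInterpolable f g p := by
  choose x y hA hB hC using H
  refine ⟨fun i => famInf fun k => x k i,
    Function.update (fun j => famSup fun k => y k j) j₀ (famInf fun k => y k j₀), ?_,
    fun i => (hf i).le_map_famInf_sup hK fun k => hB k i, fun j => ?_⟩
  · set z := Function.update (fun j => famSup fun k => y k j) j₀ (famInf fun k => y k j₀) with hz
    have hz₀ : (famInf fun k => y k j₀) ≤ famSup z := by
      simpa [hz] using le_famSup hJ z j₀
    rw [← sup_eq_left.2 hz₀, ← sup_assoc]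
    refine le_sup_of_isGLB hK (isGLB_famInf (k := κ) hK _) fun k => ?_
    refine (inf_le_inf_right _ (le_famInf hI fun i => ?_)).trans ((hA k).trans
      (sup_le (le_sup_left.trans le_sup_left) (famSup_le hJ fun j => ?_)))
    · exact (famInf_le hI _ i).trans (famInf_le hK (fun k => x k i) k)
    · by_cases hj : j = j₀
      · subst hj
        exact le_sup_right
      · have := le_famSup hJ z j
        rw [hz, Function.update_of_ne hj] at this
        exact (((le_famSup hK (fun k => y k j) k).trans this).trans le_sup_right).trans le_sup_left
  · by_cases hj : j = j₀
    · subst hj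
      have := hv (g j (famInf fun k => y k j)) ⊥ fun k => by
        have := hC k j
        simp only [Function.update_self] at this
        rw [sup_bot_eq]
        exact (inf_le_inf_left _
          ((hg j).monotone hκ (famInf_le hK (fun k => y k j) k))).trans this
      rw [sup_bot_eq] at this
      simpa using this
    · rw [Function.update_of_ne hj]
      refine (hg j).inf_map_famSup_le hK fun k => ?_
      simpa [Function.update_of_ne hj] using hC k j

/-! ### The slots of the poset of sequents without interpolants -/

variable (f g) in
/-- The poset of the sequents without interpolants, lifted to a larger universe. -/
abbrev Consistent : Type (max u v w) :=
  ULift.{w} {p : BilaxSequent A B C // ¬ IsInterpolable f g p}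

/-- A valid rule with unprovable conclusion has an unprovable premise, and that premise is the
required strengthening. -/
theorem isSlot_a (hI : IsAry κ I) (hJ : IsAry κ J)
    (hf : ∀ i, IsFrmHom κ κ (f i)) (hg : ∀ j, IsFrmHom κ κ (g j)) :
    IsSlot κ (fun p : Consistent.{u, v, w} f g => p.down.1.aL) (fun p => p.down.1.aR) where
  monotone _ _ h := h.1.1
  antitone _ _ h := h.1.2
  exists_le p K hK l r hl hr hv := by
    obtain ⟨k, hk⟩ := not_forall.1 (mt (isInterpolable_of_aRule hI hJ hK hf hg hv) p.down.2)
    exact ⟨k, ⟨⟨_, hk⟩⟩, ⟨⟨hl k, hr k⟩, ⟨le_rfl, le_rfl⟩, le_rfl, le_rfl⟩, le_rfl, le_rfl⟩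

theorem isSlot_b (hκ : κ.IsInfiniteRegular) (hI : IsAry κ I) (hJ : IsAry κ J)
    (hf : ∀ i, IsFrmHom κ κ (f i)) (hg : ∀ j, IsFrmHom κ κ (g j)) (i : I) :
    IsSlot κ (fun p : Consistent.{u, v, w} f g => p.down.1.bL i) (fun p => p.down.1.bR i) where
  monotone _ _ h := h.2.1.1 i
  antitone _ _ h := h.2.1.2 i
  exists_le p K hK l r hl hr hv := by
    classical
    obtain ⟨k, hk⟩ := not_forall.1
      (mt (isInterpolable_of_bRule hκ hI hJ hK hf hg i hv) p.down.2)
    exact ⟨k, ⟨⟨_, hk⟩⟩, ⟨⟨le_rfl, le_rfl⟩, ⟨update_le_self_iff.2 (hl k),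
      le_update_self_iff.2 (hr k)⟩, le_rfl, le_rfl⟩,
      (Function.update_self i (l k) _).le, (Function.update_self i (r k) _).ge⟩

theorem isSlot_c (hκ : κ.IsInfiniteRegular) (hI : IsAry κ I) (hJ : IsAry κ J)
    (hf : ∀ i, IsFrmHom κ κ (f i)) (hg : ∀ j, IsFrmHom κ κ (g j)) (j : J) :
    IsSlot κ (fun p : Consistent.{u, v, w} f g => p.down.1.cL j) (fun p => p.down.1.cR j) where
  monotone _ _ h := h.2.2.1 j
  antitone _ _ h := h.2.2.2 j
  exists_le p K hK l r hl hr hv := by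
    classical
    obtain ⟨k, hk⟩ := not_forall.1
      (mt (isInterpolable_of_cRule hκ hI hJ hK hf hg j hv) p.down.2)
    exact ⟨k, ⟨⟨_, hk⟩⟩, ⟨⟨le_rfl, le_rfl⟩, ⟨le_rfl, le_rfl⟩, update_le_self_iff.2 (hl k),
      le_update_self_iff.2 (hr k)⟩,
      (Function.update_self j (l k) _).le, (Function.update_self j (r k) _).ge⟩

theorem isBilaxCocone_val (hκ : κ.IsInfiniteRegular) (hI : IsAry κ I) (hJ : IsAry κ J)
    (hf : ∀ i, IsFrmHom κ κ (f i)) (hg : ∀ j, IsFrmHom κ κ (g j)) :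
    IsBilaxCocone κ f g (isSlot_a.{u, v, w} hI hJ hf hg).val
      (fun i => (isSlot_b.{u, v, w} hκ hI hJ hf hg i).val)
      (fun j => (isSlot_c.{u, v, w} hκ hI hJ hf hg j).val) where
  hom := (isSlot_a hI hJ hf hg).isFrmHom_val hκ
  hom_B i := (isSlot_b hκ hI hJ hf hg i).isFrmHom_val hκ
  hom_C j := (isSlot_c hκ hI hJ hf hg j).isFrmHom_val hκ
  le_B i a p hp := by
    refine (isSlot_a hI hJ hf hg).mem_val.2 fun q hq ha => ?_
    -- Decide `f i a` below `q`: one answer makes `t` provable through the interpolant `a`, the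
    -- other contradicts that `p` forces `f i a`.
    obtain ⟨t, ht, h | h⟩ := (isSlot_b hκ hI hJ hf hg i).exists_le_or_le hκ q (f i a)
    · exact t.down.2 (isInterpolable_of_b_le_a hκ hI hf hg h (ha.trans ht.1.2))
    · exact (isSlot_b hκ hI hJ hf hg i).mem_val.1 hp t (ht.trans hq) h
  le_C j a p hp := by
    refine (isSlot_c hκ hI hJ hf hg j).mem_val.2 fun q hq hc => ?_
    obtain ⟨t, ht, h | h⟩ := (isSlot_a hI hJ hf hg).exists_le_or_le hκ q a
    · exact t.down.2 (isInterpolable_of_a_le_c hκ hJ hf hg h (hc.trans (ht.2.2.2 j)))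
    · exact (isSlot_a hI hJ hf hg).mem_val.1 hp t (ht.trans hq) h

end BilaxSequent

theorem mainTheorem1 (κ : Arity.{u}) (hκ : κ.IsInfiniteRegular)
    {I J : Type u} (hI : IsAry κ I) (hJ : IsAry κ J)
    {A : Type v} {B : I → Type v} {C : J → Type v} {D : Type w}
    [Lattice A] [BoundedOrder A] [IsFrm κ κ A]
    [∀ i, Lattice (B i)] [∀ i, BoundedOrder (B i)] [∀ i, IsFrm κ κ (B i)]
    [∀ j, Lattice (C j)] [∀ j, BoundedOrder (C j)] [∀ j, IsFrm κ κ (C j)]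
    [Lattice D] [BoundedOrder D] [IsFrm κ κ D]
    (f : ∀ i, A → B i) (hf : ∀ i, IsFrmHom κ κ (f i))
    (g : ∀ j, A → C j) (hg : ∀ j, IsFrmHom κ κ (g j))
    (ι : A → D) (ιB : ∀ i, B i → D) (ιC : ∀ j, C j → D)
    (hD : IsBilaxPushout κ f g ι ιB ιC)
    (aL aR : A) (bL bR : ∀ i, B i) (cL cR : ∀ j, C j)
    (h : ι aL ⊓ famInf (fun i => ιB i (bL i)) ⊓ famInf (fun j => ιC j (cL j)) ≤
      ι aR ⊔ famSup (fun i => ιB i (bR i)) ⊔ famSup (fun j => ιC j (cR j))) :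
    ∃ (aL' : I → A) (aR' : J → A),
      famInf aL' ⊓ aL ≤ aR ⊔ famSup aR' ∧
      (∀ i, bL i ≤ f i (aL' i) ⊔ bR i) ∧
      (∀ j, cL j ⊓ g j (aR' j) ≤ cR j) := by
  by_contra hno
  let p : BilaxSequent.Consistent.{u, v, w} f g := ⟨⟨⟨aL, aR, bL, bR, cL, cR⟩, hno⟩⟩
  have sA := BilaxSequent.isSlot_a.{u, v, w} hI hJ hf hg
  have sB := BilaxSequent.isSlot_b.{u, v, w} hκ hI hJ hf hg
  have sC := BilaxSequent.isSlot_c.{u, v, w} hκ hI hJ hf hg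
  -- Only existence of the comparison map is needed. The lift in `Consistent` places the algebra in
  -- the universe of the test frames.
  obtain ⟨e, ⟨he, heA, heB, heC⟩, -⟩ := hD.existsUnique_hom _ _ _ _
    (BilaxSequent.isBilaxCocone_val.{u, v, w} hκ hI hJ hf hg)
  -- `U` is the regular lower set generated by `p`
  let U : RegularLowerSet (BilaxSequent.Consistent.{u, v, w} f g) :=
    Heyting.Regular.toRegular (LowerSet.Iic p)
  have hpU : p ∈ (U : LowerSet _) :=
    (le_compl_compl : LowerSet.Iic p ≤ (LowerSet.Iic p)ᶜᶜ) (LowerSet.mem_Iic_iff.2 le_rfl)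
  have hU : ∀ V : RegularLowerSet _, p ∈ (V : LowerSet _) → U ≤ V := fun V hV => by
    rw [← Heyting.Regular.coe_le_coe, Heyting.Regular.coe_toRegular, ← V.prop.eq]
    exact compl_le_compl (compl_le_compl (LowerSet.Iic_le.2 hV))
  have hU' : ∀ V : RegularLowerSet _, (∀ q ≤ p, q ∉ (V : LowerSet _)) → V ≤ Uᶜ := fun V hV => by
    rw [le_compl_comm]
    refine hU _ ?_
    rw [Heyting.Regular.coe_compl]
    exact LowerSet.mem_heyting_compl.2 hV
  -- The condition `p` forces each of its left entries, while no strengthening of `p` forces any of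
  -- its right entries. Passing to `U` and `Uᶜ` carries this through `κ`-ary meets and joins.
  have hL : U ≤ e (ι aL ⊓ famInf (fun i => ιB i (bL i)) ⊓ famInf (fun j => ιC j (cL j))) := by
    rw [he.map_inf hκ, he.map_inf hκ, heA]
    refine le_inf (le_inf (hU _ (sA.mem_val_of_le hκ le_rfl)) ?_) ?_
    · refine (he.map_isGLB I hI _ _ (isGLB_famInf (k := κ) hI _)).2 ?_
      rintro _ ⟨i, rfl⟩
      exact (hU _ ((sB i).mem_val_of_le hκ le_rfl)).trans_eq (heB i _).symm
    · refine (he.map_isGLB J hJ _ _ (isGLB_famInf (k := κ) hJ _)).2 ?_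
      rintro _ ⟨j, rfl⟩
      exact (hU _ ((sC j).mem_val_of_le hκ le_rfl)).trans_eq (heC j _).symm
  have hR : e (ι aR ⊔ famSup (fun i => ιB i (bR i)) ⊔ famSup (fun j => ιC j (cR j))) ≤ Uᶜ := by
    rw [he.map_sup hκ, he.map_sup hκ, heA]
    refine sup_le (sup_le (hU' _ fun q hq => sA.notMem_val_of_le hq.1.2) ?_) ?_
    · refine (he.map_isLUB I hI _ _ (isLUB_famSup (l := κ) hI _)).2 ?_
      rintro _ ⟨i, rfl⟩
      exact (heB i _).trans_le (hU' _ fun q hq => (sB i).notMem_val_of_le (hq.2.1.2 i))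
    · refine (he.map_isLUB J hJ _ _ (isLUB_famSup (l := κ) hJ _)).2 ?_
      rintro _ ⟨j, rfl⟩
      exact (heC j _).trans_le (hU' _ fun q hq => (sC j).notMem_val_of_le (hq.2.2.2 j))
  have hUU : U ≤ Uᶜ := hL.trans ((he.monotone hκ h).trans hR)
  exact LowerSet.mem_heyting_compl.1 (hUU hpU) p le_rfl hpU
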